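/- Let $\mathcal G$ be a finite directed graph on $N$ nodes (self-loops allowed), with adjacency matrix $A=(a_{i,j})\in\{0,1\}^{N\times N}$, where $a_{i,j}=1$ iff there is an edge from $j$ to $i$, and let $d^{\mathrm{in}}_i=\sum_j a_{i,j}$, $d^{\mathrm{out}}_j=\sum_i a_{i,j}$. Assume that $\mathcal G$ is strongly connected and aperiodic (the greatest common divisor of the lengths of its directed cycles is $1$; in particular there is a directed cycle). Let $L=D_{\mathrm{in}}^{-1/2}AD_{\mathrm{out}}^{-1/2}$ with $D_{\mathrm{in}}=\mathrm{diag}(d^{\mathrm{in}}_i)$, $D_{\mathrm{out}}=\mathrm{diag}(d^{\mathrm{out}}_j)$ be the symmetrically normalized adjacency (SNA), and for $x\in\mathbb R^{N\times K}$ with rows $x_i$ define the Dirichlet energy $$\mathfrak E(x)=\frac14\sum_{i,j=1}^N a_{i,j}\left\|\frac{x_i}{\sqrt{d^{\mathrm{in}}_i}}-\frac{x_j}{\sqrt{d^{\mathrm{out}}_j}}\right\|_2^2 .$$ Let $W\in\mathbb R^{K\times K}$ be any matrix that is not nilpotent (for instance, any nonzero symmetric matrix), and consider the GCN update rule $x_{t+1}=Lx_tW$,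 $t=0,1,2,\dots$, with input node features $x_0\in\mathbb R^{N\times K}$. Then the GCN oversmooths. That is, among the complex eigenvalues of $I-L$ the smallest real part is attained at a real eigenvalue $\lambda_1\ge 0$, and for (Lebesgue-)almost every $x_0\in\mathbb R^{N\times K}$ the following holds: $x_t\neq 0$ for all $t\ge 0$; the normalized Dirichlet energy converges to the lowest-frequency value (the dynamics is lowest-frequency-dominant), $$\mathfrak E\!\left(\frac{x_t}{\|x_t\|_F}\right)\xrightarrow[t\to\infty]{}\frac{\lambda_1}{2};$$ and it does so exponentially fast, i.e. there is a constant $C>0$ (depending on $\mathcal G$, $W$ and $x_0$) such that for all integers $t\ge 1$ $$\left|\mathfrak E\!\left(\frac{x_t}{\|x_t\|_F}\right)-\frac{\lambda_1}{2}\right|\le e^{-Ct}.$$ -/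

import Mathlib

open MeasureTheory Filter Topology

noncomputable section

namespace Digraph

variable {V : Type*} (G : Digraph V)

/-- There is a directed walk with exactly `n` edges from `u` to `v`. -/
def HasWalk : ℕ → V → V → Prop
  | 0, u, v => u = v
  | n + 1, u, v => ∃ w, G.Adj u w ∧ HasWalk n w v

/-- Any node can be reached from any other node along a directed walk. -/
def IsStronglyConnected : Prop := ∀ u v : V, ∃ n : ℕ, G.HasWalk n u v

/-- The greatest common divisor of the lengths of all directed cycles (equivalently, of all
closed directed walks) exists and is `1`. A graph without directed cycles is not aperiodic. -/
def IsAperiodic : Prop :=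
  ∀ d : ℕ, (∀ (n : ℕ) (v : V), G.HasWalk n v v → d ∣ n) → d = 1

open Classical in
/-- The adjacency matrix: the entry `(i, j)` is `1` if there is an edge from `j` to `i`. -/
def adjacency : Matrix V V ℝ := Matrix.of fun i j => if G.Adj j i then 1 else 0

variable [Fintype V]

/-- In-degree: row sums of the adjacency matrix. -/
def inDeg (i : V) : ℝ := ∑ j, G.adjacency i j

/-- Out-degree: column sums of the adjacency matrix. -/
def outDeg (j : V) : ℝ := ∑ i, G.adjacency i j

/-- The Dirichlet energy of real node features. -/
def dirichletEnergy {κ : Type*} [Fintype κ] (x : Matrix V κ ℝ) : ℝ :=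
  (1 / 4) * ∑ i, ∑ j, G.adjacency i j *
    ∑ k, (x i k / √(G.inDeg i) - x j k / √(G.outDeg j)) ^ 2

variable [DecidableEq V]

/-- The symmetrically normalized adjacency `D_in^(-1/2) A D_out^(-1/2)`. -/
def sna : Matrix V V ℝ :=
  Matrix.diagonal (fun i => (√(G.inDeg i))⁻¹) * G.adjacency *
    Matrix.diagonal (fun j => (√(G.outDeg j))⁻¹)

/-- The set of complex eigenvalues (frequencies) of the symmetrically normalized Laplacian
`I - L`, where `L` is the symmetrically normalized adjacency. -/
def frequencies : Set ℂ := spectrum ℂ ((1 - G.sna).map (fun r : ℝ => (r : ℂ)))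

/-- The real number `l` is an eigenvalue of `I - L`, and it is smallest among all the complex
eigenvalues with respect to the real part. -/
def IsLowestFrequency (l : ℝ) : Prop :=
  (l : ℂ) ∈ G.frequencies ∧ ∀ z ∈ G.frequencies, l ≤ z.re

/-- The node features after `t` layers, `x_{t+1} = L x_t W`. -/
def gcn {κ : Type*} [Fintype κ] (W : Matrix κ κ ℝ) (x₀ : Matrix V κ ℝ) : ℕ → Matrix V κ ℝ
  | 0 => x₀
  | t + 1 => G.sna * gcn W x₀ t * W

end Digraph

/-- The node features divided by their Frobenius norm. -/
def normalizeFeatures {V κ : Type*} [Fintype V] [Fintype κ] (x : Matrix V κ ℝ) : Matrix V κ ℝ :=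
  (√(∑ i, ∑ k, x i k ^ 2))⁻¹ • x

namespace Digraph

variable {V κ : Type*} (G : Digraph V) [Fintype V] [Fintype κ]

/-- The sequence of node features is `l`-frequency-dominant: its normalized Dirichlet energy tends
to `l / 2`. -/
def IsFrequencyDominant (x : ℕ → Matrix V κ ℝ) (l : ℝ) : Prop :=
  Tendsto (fun t => G.dirichletEnergy (normalizeFeatures (x t))) atTop (𝓝 (l / 2))

/-- The normalized Dirichlet energy approaches `l / 2` exponentially fast. -/
def DecaysExponentially (x : ℕ → Matrix V κ ℝ) (l : ℝ) : Prop :=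
  ∃ C : ℝ, 0 < C ∧ ∀ t : ℕ, 0 < t →
    |G.dirichletEnergy (normalizeFeatures (x t)) - l / 2| ≤ Real.exp (-C * t)

end Digraph

end

/-! Strong connectivity and aperiodicity make `L` primitive, so it has a positive left eigenvector
`u` with eigenvalue `ρ > 0`, and `λ₁ = 1 - ρ`. The energy is the quadratic form `(‖x‖² - ⟨x, L x⟩) /
2`, which gives `ρ ≤ 1` and bounds the deviation of the normalized energy from `λ₁ / 2` by the
entrywise `ℓ¹` norm of `(L - ρ) x`, divided by `‖x‖`.

For `x_t = L ^ t x₀ W ^ t` the numerator is `O((q c) ^ t)`: the factor `L - ρ` removes the Perron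
part (`Matrix.exists_abs_sub_smul_mul_pow_le`, `q < ρ`), and `c` slightly exceeds the spectral
radius `|μ|` of `W`. Pairing `x_t` with `u` and with an eigenvector of `W` for `μ` multiplies by `ρ
μ` at each layer, so for almost every `x₀` the denominator is at least a multiple of `(ρ |μ|) ^ t`.
Non-nilpotency gives `μ ≠ 0`, and `c` is chosen with `q c < ρ |μ|`.

The required bound `e^{-Ct}` has no prefactor, so each deviation must also be strictly below `1`;
this is `abs_dirichletEnergy_normalizeFeatures_sub_lt_one`. -/

namespace Digraph

variable {V : Type*} {G : Digraph V}

/-! ### Walk lengths and primitivity -/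

theorem HasWalk.append {m n : ℕ} {u v w : V} (h : G.HasWalk m u v) (h' : G.HasWalk n v w) :
    G.HasWalk (m + n) u w := by
  induction m generalizing u with
  | zero => cases h; simpa using h'
  | succ m ih =>
    obtain ⟨a, ha, hw⟩ := h
    rw [Nat.add_right_comm]
    exact ⟨a, ha, ih hw⟩

theorem HasWalk.exists_adj_last {n : ℕ} {u v : V} (h : G.HasWalk (n + 1) u v) :
    ∃ w, G.Adj w v := by
  induction n generalizing u with
  | zero => obtain ⟨w, hw, rfl⟩ := h; exact ⟨u, hw⟩
  | succ n ih => obtain ⟨w, -, hw⟩ := h; exact ih hw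

/-- The additive submonoid of lengths of closed walks at a node. -/
def closedWalkLengths (G : Digraph V) (v : V) : AddSubmonoid ℕ where
  carrier := {n | G.HasWalk n v v}
  zero_mem' := rfl
  add_mem' := HasWalk.append

/-- Inserting a closed walk at `w` into a round trip from `v` through `w` shows that the gcd of
closed walk lengths at `v` divides every closed walk length in the graph. A submonoid of `ℕ` with
gcd `1` contains all large numbers. -/
theorem exists_forall_ge_hasWalk_self (hconn : G.IsStronglyConnected) (haper : G.IsAperiodic)
    (v : V) : ∃ N, ∀ n ≥ N, G.HasWalk n v v := by
  have hgcd : Nat.setGcd (G.closedWalkLengths v : Set ℕ) = 1 := by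
    refine haper _ fun n w hw => ?_
    obtain ⟨a, ha⟩ := hconn v w
    obtain ⟨b, hb⟩ := hconn w v
    have h1 := Nat.setGcd_dvd_of_mem (s := (G.closedWalkLengths v : Set ℕ)) (ha.append hb)
    have h2 := Nat.setGcd_dvd_of_mem (s := (G.closedWalkLengths v : Set ℕ))
      (ha.append (hw.append hb))
    rw [show a + (n + b) = n + (a + b) by ring] at h2
    exact (Nat.dvd_add_iff_left h1).2 h2
  obtain ⟨N, hN⟩ := Nat.exists_mem_closure_of_ge (G.closedWalkLengths v : Set ℕ)
  refine ⟨N, fun n hn => ?_⟩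
  have := hN n hn (by rw [hgcd]; exact one_dvd n)
  rwa [AddSubmonoid.closure_eq] at this

theorem IsAperiodic.nonempty (haper : G.IsAperiodic) : Nonempty V := by
  by_contra h
  exact absurd (haper 2 fun n v => (h ⟨v⟩).elim) (by norm_num)

theorem exists_forall_hasWalk [Finite V] (hconn : G.IsStronglyConnected)
    (haper : G.IsAperiodic) : ∃ m, m ≠ 0 ∧ ∀ u v, G.HasWalk m u v := by
  obtain ⟨v₀⟩ := haper.nonempty
  cases nonempty_fintype V
  obtain ⟨N, hN⟩ := exists_forall_ge_hasWalk_self hconn haper v₀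
  choose a ha using fun u => hconn u v₀
  choose b hb using hconn v₀
  -- All walks are routed through `v₀`, where a closed walk of length at least `N` absorbs the
  -- slack; the `+ 1` makes the length nonzero.
  refine ⟨N + 1 + ∑ u, a u + ∑ u, b u, by omega, fun u v => ?_⟩
  have hau := Finset.single_le_sum (fun i _ => Nat.zero_le (a i)) (Finset.mem_univ u)
  have hbv := Finset.single_le_sum (fun i _ => Nat.zero_le (b i)) (Finset.mem_univ v)
  obtain ⟨c, hc⟩ : ∃ c, N + 1 + ∑ u, a u + ∑ u, b u = a u + (c + b v) ∧ N ≤ c :=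
    ⟨N + 1 + ∑ u, a u + ∑ u, b u - a u - b v, by omega, by omega⟩
  rw [hc.1]
  exact (ha u).append ((hN c hc.2).append (hb v))

theorem adjacency_nonneg (i j : V) : 0 ≤ G.adjacency i j := by
  unfold adjacency; simp only [Matrix.of_apply]; split_ifs <;> norm_num

theorem adjacency_pos {i j : V} (h : G.Adj j i) : 0 < G.adjacency i j := by
  simp [adjacency, h]

/-- A nonnegative matrix supported on all edges has powers that are positive along walks. -/
theorem HasWalk.pow_apply_pos [Fintype V] [DecidableEq V] {B : Matrix V V ℝ}
    (hB : ∀ i j, 0 ≤ B i j) (hG : ∀ i j, G.Adj j i → 0 < B i j) {n : ℕ} {u v : V}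
    (h : G.HasWalk n u v) : 0 < (B ^ n) v u := by
  induction n generalizing u with
  | zero => cases h; simp
  | succ n ih =>
    obtain ⟨w, hw, hwv⟩ := h
    rw [pow_succ, Matrix.mul_apply]
    exact Finset.sum_pos' (fun k _ => mul_nonneg (Matrix.pow_apply_nonneg hB n v k) (hB k u))
      ⟨w, Finset.mem_univ w, mul_pos (ih hwv) (hG w u hw)⟩

variable [Fintype V]

theorem inDeg_pos {i j : V} (h : G.Adj j i) : 0 < G.inDeg i :=
  Finset.sum_pos' (fun _ _ => adjacency_nonneg _ _) ⟨j, Finset.mem_univ j, adjacency_pos h⟩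

theorem outDeg_pos {i j : V} (h : G.Adj j i) : 0 < G.outDeg j :=
  Finset.sum_pos' (fun _ _ => adjacency_nonneg _ _) ⟨i, Finset.mem_univ i, adjacency_pos h⟩

variable [DecidableEq V]

theorem sna_apply (i j : V) :
    G.sna i j = (√(G.inDeg i))⁻¹ * G.adjacency i j * (√(G.outDeg j))⁻¹ := by
  simp [sna, Matrix.mul_diagonal, Matrix.diagonal_mul]

theorem sna_nonneg (i j : V) : 0 ≤ G.sna i j := by
  rw [sna_apply]
  have := adjacency_nonneg (G := G) i j
  positivity

theorem sna_pos {i j : V} (h : G.Adj j i) : 0 < G.sna i j := by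
  rw [sna_apply]
  have := adjacency_pos h
  have := inDeg_pos h
  have := outDeg_pos h
  positivity

/-- The degrees are positive, and some power of the normalized adjacency is positive. -/
theorem exists_sna_pow_pos (hconn : G.IsStronglyConnected) (haper : G.IsAperiodic) :
    (∀ i, 0 < G.inDeg i) ∧ (∀ i, 0 < G.outDeg i) ∧
      ∃ m, m ≠ 0 ∧ ∀ i j, 0 < (G.sna ^ m) i j := by
  obtain ⟨m, hm, h⟩ := exists_forall_hasWalk hconn haper
  refine ⟨fun i => ?_, fun i => ?_, m, hm,
    fun i j => (h j i).pow_apply_pos sna_nonneg fun _ _ => sna_pos⟩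
  all_goals obtain ⟨n, rfl⟩ := Nat.exists_eq_succ_of_ne_zero hm
  · obtain ⟨w, hw⟩ := (h i i).exists_adj_last
    exact inDeg_pos hw
  · obtain ⟨w, hw, -⟩ := h i i
    exact outDeg_pos hw

end Digraph

/-! ### Spectrum and growth of powers -/

namespace Matrix

variable {n : Type*} [Fintype n] [DecidableEq n]

theorem mem_spectrum_iff_exists_mulVec {K : Type*} [Field K] {M : Matrix n n K} {μ : K} :
    μ ∈ spectrum K M ↔ ∃ w : n → K, w ≠ 0 ∧ M *ᵥ w = μ • w := by
  rw [← Matrix.spectrum_toLin', ← Module.End.hasEigenvalue_iff_mem_spectrum]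
  constructor
  · intro h
    obtain ⟨w, hw⟩ := h.exists_hasEigenvector
    exact ⟨w, hw.2, by simpa using hw.apply_eq_smul⟩
  · rintro ⟨w, hw, h⟩
    exact Module.End.hasEigenvalue_of_hasEigenvector (x := w)
      ⟨Module.End.mem_eigenspace_iff.2 (by simpa using h), hw⟩

attribute [local instance] Matrix.linftyOpNormedRing Matrix.linftyOpNormedAlgebra

theorem norm_apply_le_linftyOpNorm (M : Matrix n n ℂ) (i j : n) : ‖M i j‖ ≤ ‖M‖ := by
  have h := Finset.le_sup (f := fun i => ∑ j, ‖M i j‖₊) (Finset.mem_univ i)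
  have h2 : ‖M i j‖₊ ≤ ∑ j, ‖M i j‖₊ :=
    Finset.single_le_sum (f := fun j => ‖M i j‖₊) (fun _ _ => zero_le) (Finset.mem_univ j)
  have h3 : ‖M i j‖₊ ≤ ‖M‖₊ := by
    rw [Matrix.linfty_opNNNorm_def]; exact h2.trans h
  exact_mod_cast h3

/-- If the spectrum lies in an open disc, the powers are dominated by the powers of its radius. -/
theorem exists_norm_pow_apply_le (M : Matrix n n ℂ) {c : ℝ} (hc : 0 < c)
    (h : ∀ μ ∈ spectrum ℂ M, ‖μ‖ < c) : ∃ C : ℝ, 0 < C ∧ ∀ t i j, ‖(M ^ t) i j‖ ≤ C * c ^ t := by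
  rcases isEmpty_or_nonempty n with _ | _
  · exact ⟨1, one_pos, fun t i => isEmptyElim i⟩
  have hr : spectralRadius ℂ M < ENNReal.ofReal c := by
    refine spectrum.spectralRadius_lt_of_forall_lt M (r := c.toNNReal) fun μ hμ => ?_
    rw [← NNReal.coe_lt_coe, Real.coe_toNNReal c hc.le]
    exact h μ hμ
  -- Gelfand's formula handles large `t`; the finitely many others go into the constant. The
  -- threshold `N + 1` excludes `t = 0`, where the exponent `1 / t` is useless.
  have hlim := (spectrum.pow_norm_pow_one_div_tendsto_nhds_spectralRadius M).eventually_lt_const hr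
  obtain ⟨N, hN⟩ := eventually_atTop.1 hlim
  have hbig : ∀ t ≥ N + 1, ‖M ^ t‖ ≤ c ^ t := by
    intro t ht
    have h1 := hN t (by omega)
    have h2 := (ENNReal.ofReal_lt_ofReal_iff hc).1 h1
    have ht0 : (t : ℝ) ≠ 0 := by exact_mod_cast (by omega : t ≠ 0)
    calc ‖M ^ t‖ = (‖M ^ t‖ ^ (1 / t : ℝ)) ^ t := by
          rw [← Real.rpow_natCast, ← Real.rpow_mul (norm_nonneg _), one_div_mul_cancel ht0,
            Real.rpow_one]
      _ ≤ c ^ t := by gcongr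
  have hpos : ∀ t : ℕ, 0 ≤ ‖M ^ t‖ / c ^ t := fun t => by positivity
  refine ⟨1 + ∑ t ∈ Finset.range (N + 1), ‖M ^ t‖ / c ^ t,
    add_pos_of_pos_of_nonneg one_pos (Finset.sum_nonneg fun t _ => hpos t), fun t i j => ?_⟩
  refine (norm_apply_le_linftyOpNorm _ i j).trans ?_
  rw [← div_le_iff₀ (by positivity)]
  rcases lt_or_ge t (N + 1) with ht | ht
  · have := Finset.single_le_sum (fun t _ => hpos t) (Finset.mem_range.2 ht)
    linarith
  · have h1 : ‖M ^ t‖ / c ^ t ≤ 1 := (div_le_one (by positivity)).2 (hbig t ht)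
    have := Finset.sum_nonneg fun t (_ : t ∈ Finset.range (N + 1)) => hpos t
    linarith

theorem exists_mem_spectrum_forall_norm_le [Nonempty n] (M : Matrix n n ℂ) :
    ∃ μ ∈ spectrum ℂ M, ∀ z ∈ spectrum ℂ M, ‖z‖ ≤ ‖μ‖ := by
  obtain ⟨μ, hμ, h⟩ := spectrum.exists_nnnorm_eq_spectralRadius M
  refine ⟨μ, hμ, fun z hz => ?_⟩
  have : (‖z‖₊ : ENNReal) ≤ spectralRadius ℂ M :=
    le_iSup₂ (f := fun z (_ : z ∈ spectrum ℂ M) => (‖z‖₊ : ENNReal)) z hz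
  rw [← h] at this
  exact_mod_cast this

theorem isNilpotent_of_spectrum_eq_zero (M : Matrix n n ℂ) (h : ∀ μ ∈ spectrum ℂ M, μ = 0) :
    IsNilpotent M := by
  have hs := IsAlgClosed.splits M.charpoly
  have hroots : M.charpoly.roots = Multiset.replicate (Multiset.card M.charpoly.roots) 0 :=
    Multiset.eq_replicate_card.2 fun μ hμ =>
      h μ (mem_spectrum_iff_isRoot_charpoly.2 (Polynomial.isRoot_of_mem_roots hμ))
  have hX : M.charpoly = Polynomial.X ^ (Multiset.card M.charpoly.roots) := by
    conv_lhs => rw [hs.eq_prod_roots_of_monic M.charpoly_monic, hroots]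
    simp
  refine ⟨Multiset.card M.charpoly.roots, ?_⟩
  have := M.aeval_self_charpoly
  rwa [hX, map_pow, Polynomial.aeval_X] at this

end Matrix

/-! ### Perron–Frobenius theory for primitive matrices -/

namespace Matrix

variable {n : Type*} [Fintype n] [DecidableEq n]

theorem map_ofReal_pow (L : Matrix n n ℝ) (t : ℕ) :
    L.map Complex.ofReal ^ t = (L ^ t).map Complex.ofReal :=
  (map_pow Complex.ofRealHom.mapMatrix L t).symm

theorem exists_abs_pow_apply_le (L : Matrix n n ℝ) {c : ℝ} (hc : 0 < c)
    (h : ∀ μ ∈ spectrum ℂ (L.map Complex.ofReal), ‖μ‖ < c) :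
    ∃ C : ℝ, 0 < C ∧ ∀ t i j, |(L ^ t) i j| ≤ C * c ^ t := by
  obtain ⟨C, hC, hb⟩ := exists_norm_pow_apply_le _ hc h
  refine ⟨C, hC, fun t i j => ?_⟩
  have := hb t i j
  rwa [map_ofReal_pow, map_apply, Complex.norm_real, Real.norm_eq_abs] at this

theorem pow_mulVec_eq_smul {K : Type*} [CommSemiring K] {L : Matrix n n K} {v : n → K} {μ : K}
    (h : L *ᵥ v = μ • v) (t : ℕ) : (L ^ t) *ᵥ v = μ ^ t • v := by
  induction t with
  | zero => simp
  | succ t ih => rw [pow_succ, ← mulVec_mulVec, h, mulVec_smul, ih, smul_smul, pow_succ']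

omit [DecidableEq n] in
theorem mulVec_nonneg_of_nonneg {P : Matrix n n ℝ} (hP : ∀ i j, 0 ≤ P i j) {y : n → ℝ}
    (hy : 0 ≤ y) : 0 ≤ P *ᵥ y := fun i =>
  Finset.sum_nonneg fun j _ => mul_nonneg (hP i j) (hy j)

omit [DecidableEq n] in
theorem dotProduct_pos_of_pos {u y : n → ℝ} (hu : ∀ i, 0 < u i) (hy : 0 ≤ y) (hne : y ≠ 0) :
    0 < u ⬝ᵥ y := by
  obtain ⟨j, hj⟩ := Function.ne_iff.1 hne
  exact Finset.sum_pos' (fun k _ => mul_nonneg (hu k).le (hy k))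
    ⟨j, Finset.mem_univ j, mul_pos (hu j) (lt_of_le_of_ne (hy j) (Ne.symm hj))⟩

omit [DecidableEq n] in
theorem mulVec_pos_of_pos {P : Matrix n n ℝ} (hP : ∀ i j, 0 < P i j) {y : n → ℝ}
    (hy : 0 ≤ y) (hne : y ≠ 0) (i : n) : 0 < (P *ᵥ y) i :=
  dotProduct_pos_of_pos (hP i) hy hne

omit [DecidableEq n] in
theorem norm_smul_le_mulVec_norm {L : Matrix n n ℝ} (hL : ∀ i j, 0 ≤ L i j) {w : n → ℂ} {μ : ℂ}
    (h : L.map Complex.ofReal *ᵥ w = μ • w) :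
    ‖μ‖ • (fun i => ‖w i‖) ≤ L *ᵥ fun i => ‖w i‖ := by
  intro i
  have h1 := congrFun h i
  calc ‖μ‖ * ‖w i‖ = ‖(L.map Complex.ofReal *ᵥ w) i‖ := by rw [h1]; simp
    _ ≤ ∑ j, ‖(L i j : ℂ) * w j‖ := norm_sum_le _ _
    _ = ∑ j, L i j * ‖w j‖ := by
      refine Finset.sum_congr rfl fun j _ => ?_
      rw [norm_mul, Complex.norm_real, Real.norm_of_nonneg (hL i j)]

/-- If `L z ≥ c z` for a positive vector `z`, then `c` does not exceed the growth rate of `L`. -/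
theorem le_of_forall_smul_le_mulVec [Nonempty n] {L : Matrix n n ℝ} (hL : ∀ i j, 0 ≤ L i j)
    {z : n → ℝ} (hz : ∀ i, 0 < z i) {c d C : ℝ} (hc : 0 ≤ c) (hd : 0 < d)
    (h : c • z ≤ L *ᵥ z) (hb : ∀ t i j, |(L ^ t) i j| ≤ C * d ^ t) : c ≤ d := by
  have hpow : ∀ t : ℕ, c ^ t • z ≤ (L ^ t) *ᵥ z := by
    intro t
    induction t with
    | zero => simp
    | succ t ih =>
      have h1 := mulVec_nonneg_of_nonneg hL (sub_nonneg.2 ih)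
      rw [mulVec_sub, mulVec_smul, mulVec_mulVec, ← pow_succ', sub_nonneg] at h1
      refine le_trans ?_ h1
      rw [pow_succ, mul_smul]
      exact smul_le_smul_of_nonneg_left h (pow_nonneg hc t)
  by_contra! hlt
  obtain ⟨i⟩ := ‹Nonempty n›
  have hr : 1 < c / d := (one_lt_div hd).2 hlt
  obtain ⟨t, ht⟩ := pow_unbounded_of_one_lt (C * (∑ j, z j) / z i) hr
  rw [div_pow, div_lt_div_iff₀ (hz i) (pow_pos hd t)] at ht
  have h1 : c ^ t * z i ≤ ((L ^ t) *ᵥ z) i := hpow t i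
  have h2 : ((L ^ t) *ᵥ z) i ≤ ∑ j, C * d ^ t * z j :=
    Finset.sum_le_sum fun j _ =>
      mul_le_mul_of_nonneg_right ((le_abs_self _).trans (hb t i j)) (hz j).le
  rw [← Finset.mul_sum] at h2
  linarith

/-- **Perron's theorem**: a primitive matrix has a positive eigenvector. -/
theorem exists_pos_eigenvector [Nonempty n] {L : Matrix n n ℝ} (hL : ∀ i j, 0 ≤ L i j) {m : ℕ}
    (hm : m ≠ 0) (hpos : ∀ i j, 0 < (L ^ m) i j) :
    ∃ (ρ : ℝ) (v : n → ℝ), 0 < ρ ∧ (∀ i, 0 < v i) ∧ L *ᵥ v = ρ • v := by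
  obtain ⟨μ, hμ, hmax⟩ := exists_mem_spectrum_forall_norm_le (L.map Complex.ofReal)
  obtain ⟨w, hw, hLw⟩ := mem_spectrum_iff_exists_mulVec.1 hμ
  set y : n → ℝ := fun i => ‖w i‖
  have hy : 0 ≤ y := fun i => norm_nonneg _
  have hy0 : y ≠ 0 := by
    obtain ⟨i, hi⟩ := Function.ne_iff.1 hw
    exact Function.ne_iff.2 ⟨i, norm_ne_zero_iff.2 hi⟩
  have hle := norm_smul_le_mulVec_norm hL hLw
  -- Otherwise `L ^ m` makes the gap `L y - ‖μ‖ y` strictly positive, so `L ^ m y` grows by a factor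
  -- of at least `‖μ‖ + ε`, against the maximality of `‖μ‖`.
  have heq : L *ᵥ y = ‖μ‖ • y := by
    by_contra hne
    have hz := mulVec_pos_of_pos hpos hy hy0
    have hgap := mulVec_pos_of_pos hpos (sub_nonneg.2 hle) (sub_ne_zero.2 hne)
    obtain ⟨i₀, hi₀⟩ := Finite.exists_min fun i =>
      ((L ^ m) *ᵥ (L *ᵥ y - ‖μ‖ • y)) i / ((L ^ m) *ᵥ y) i
    set ε := ((L ^ m) *ᵥ (L *ᵥ y - ‖μ‖ • y)) i₀ / ((L ^ m) *ᵥ y) i₀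
    have hε : 0 < ε := div_pos (hgap i₀) (hz i₀)
    have hstep : (‖μ‖ + ε) • ((L ^ m) *ᵥ y) ≤ L *ᵥ ((L ^ m) *ᵥ y) := by
      intro i
      have h1 := (le_div_iff₀ (hz i)).1 (hi₀ i)
      rw [mulVec_sub, mulVec_smul, mulVec_mulVec, ← pow_succ, pow_succ', ← mulVec_mulVec] at h1
      simp only [Pi.sub_apply, Pi.smul_apply, smul_eq_mul] at h1 ⊢
      linarith
    have hd : 0 < ‖μ‖ + ε / 2 := by positivity
    obtain ⟨C, -, hC⟩ := exists_abs_pow_apply_le L hd fun z hz => by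
      have := hmax z hz
      linarith
    have := le_of_forall_smul_le_mulVec hL hz (by positivity) hd hstep hC
    linarith
  have hpow := pow_mulVec_eq_smul heq m
  have hv : ∀ i, 0 < ‖μ‖ ^ m * y i := fun i => by
    have := mulVec_pos_of_pos hpos hy hy0 i
    rwa [hpow] at this
  refine ⟨‖μ‖, y, ?_, fun i => ?_, heq⟩
  · obtain ⟨i⟩ := ‹Nonempty n›
    refine lt_of_le_of_ne (norm_nonneg _) fun h => ?_
    have := hv i
    rw [← h, zero_pow hm] at this
    simp at this
  · exact pos_of_mul_pos_right (hv i) (by positivity)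

section Perron

variable {L : Matrix n n ℝ} {ρ : ℝ} {u : n → ℝ}

omit [DecidableEq n] in
theorem norm_le_of_pos_left_eigenvector (hL : ∀ i j, 0 ≤ L i j) (hu : ∀ i, 0 < u i)
    (huL : u ᵥ* L = ρ • u) {w : n → ℂ} {μ : ℂ} (hw : w ≠ 0)
    (h : L.map Complex.ofReal *ᵥ w = μ • w) : ‖μ‖ ≤ ρ := by
  have hle := norm_smul_le_mulVec_norm hL h
  have hy0 : (fun i => ‖w i‖) ≠ 0 := by
    obtain ⟨i, hi⟩ := Function.ne_iff.1 hw
    exact Function.ne_iff.2 ⟨i, norm_ne_zero_iff.2 hi⟩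
  have hy := dotProduct_pos_of_pos hu (fun i => norm_nonneg (w i)) hy0
  have h1 := dotProduct_le_dotProduct_of_nonneg_left hle (fun i => (hu i).le)
  rw [dotProduct_mulVec, huL, dotProduct_smul, smul_dotProduct] at h1
  exact le_of_mul_le_mul_right h1 hy

omit [DecidableEq n] in
/-- Equality in the triangle inequality with positive weights aligns all the vectors. -/
theorem sum_ne_zero_of_norm_sum_eq {p : n → ℝ} (hp : ∀ i, 0 < p i) (hu : ∀ i, 0 < u i)
    {w : n → ℂ} (hw : w ≠ 0) (h : ‖∑ i, (p i : ℂ) * w i‖ = ∑ i, p i * ‖w i‖) :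
    ∑ i, (u i : ℂ) * w i ≠ 0 := by
  set s := ∑ i, (p i : ℂ) * w i
  have hy0 : (fun i => ‖w i‖) ≠ 0 := by
    obtain ⟨i, hi⟩ := Function.ne_iff.1 hw
    exact Function.ne_iff.2 ⟨i, norm_ne_zero_iff.2 hi⟩
  have hs : 0 < ‖s‖ := by
    rw [h]; exact dotProduct_pos_of_pos hp (fun i => norm_nonneg (w i)) hy0
  -- The unit scalar that rotates `s` onto the positive real axis.
  set e : ℂ := (starRingEnd ℂ) s / ‖s‖
  have he : ‖e‖ = 1 := by simp [e, hs.ne']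
  have hes : e * s = ‖s‖ := by
    have h0 : (‖s‖ : ℂ) ≠ 0 := by exact_mod_cast hs.ne'
    rw [div_mul_eq_mul_div, Complex.conj_mul', sq, mul_div_assoc, div_self h0, mul_one]
  have hre : ∀ (q : n → ℝ), (e * ∑ i, (q i : ℂ) * w i).re = ∑ i, q i * (e * w i).re := by
    intro q
    rw [Finset.mul_sum, Complex.re_sum]
    refine Finset.sum_congr rfl fun i _ => ?_
    rw [mul_left_comm, Complex.re_ofReal_mul]
  have hle : ∀ i, (e * w i).re ≤ ‖w i‖ := fun i =>
    (Complex.re_le_norm _).trans (by rw [norm_mul, he, one_mul])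
  have hsum : ∑ i, p i * (e * w i).re = ∑ i, p i * ‖w i‖ := by
    rw [← hre, ← h]
    change (e * s).re = _
    rw [hes, Complex.ofReal_re]
  have hall := (Finset.sum_eq_sum_iff_of_le fun i _ =>
    mul_le_mul_of_nonneg_left (hle i) (hp i).le).1 hsum
  intro h0
  have h1 := hre u
  rw [h0, mul_zero, Complex.zero_re] at h1
  have h2 : ∑ i, u i * (e * w i).re = u ⬝ᵥ fun i => ‖w i‖ :=
    Finset.sum_congr rfl fun i hi => by rw [mul_left_cancel₀ (hp i).ne' (hall i hi)]
  have := dotProduct_pos_of_pos hu (fun i => norm_nonneg (w i)) hy0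
  rw [← h2, ← h1] at this
  exact this.false

/-- If `‖μ‖ = ρ`, pairing with `u` forces `|w|` to be an eigenvector of `L`. A row of `L ^ m` then
gives equality in the triangle inequality, which aligns the entries of `w` and contradicts
orthogonality to `u`. -/
theorem norm_lt_of_pos_left_eigenvector [Nonempty n] (hL : ∀ i j, 0 ≤ L i j) {m : ℕ}
    (hpos : ∀ i j, 0 < (L ^ m) i j) (hu : ∀ i, 0 < u i)
    (huL : u ᵥ* L = ρ • u) {w : n → ℂ} {μ : ℂ} (hw : w ≠ 0)
    (h : L.map Complex.ofReal *ᵥ w = μ • w) (h0 : ∑ i, (u i : ℂ) * w i = 0) : ‖μ‖ < ρ := by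
  refine lt_of_le_of_ne (norm_le_of_pos_left_eigenvector hL hu huL hw h) fun heq => ?_
  have hle := norm_smul_le_mulVec_norm hL h
  have hLy : L *ᵥ (fun i => ‖w i‖) = ‖μ‖ • fun i => ‖w i‖ := by
    by_contra hne
    have := dotProduct_pos_of_pos hu (sub_nonneg.2 hle) (sub_ne_zero.2 hne)
    rw [dotProduct_sub, dotProduct_mulVec, huL, dotProduct_smul, smul_dotProduct, heq, sub_self]
      at this
    exact this.false
  obtain ⟨i⟩ := ‹Nonempty n›
  refine sum_ne_zero_of_norm_sum_eq (hpos i) hu hw ?_ h0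
  have h1 := congrFun (pow_mulVec_eq_smul h m) i
  have h2 := congrFun (pow_mulVec_eq_smul hLy m) i
  rw [map_ofReal_pow] at h1
  refine (congrArg norm h1).trans (Eq.trans ?_ h2.symm)
  simp

/-- **Perron–Frobenius**: for a primitive matrix with a positive left eigenvector, the part of the
powers away from the dominant eigenspace decays at a strictly smaller rate. -/
theorem exists_abs_sub_smul_mul_pow_le [Nonempty n] (hL : ∀ i j, 0 ≤ L i j) {m : ℕ}
    (hpos : ∀ i j, 0 < (L ^ m) i j) (hρ : 0 < ρ) (hu : ∀ i, 0 < u i) (huL : u ᵥ* L = ρ • u) :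
    ∃ q C : ℝ, 0 < q ∧ q < ρ ∧ 0 < C ∧
      ∀ t i j, |((L - ρ • (1 : Matrix n n ℝ)) * L ^ t) i j| ≤ C * q ^ t := by
  have huu : 0 < u ⬝ᵥ u := Finset.sum_pos (fun i _ => mul_pos (hu i) (hu i)) Finset.univ_nonempty
  set a : ℝ := ρ / (u ⬝ᵥ u)
  -- Deflation: `a` is chosen so that `u M = 0`. An eigenvector of `M` with nonzero eigenvalue is
  -- thus orthogonal to `u`, hence an eigenvector of `L`.
  set M : Matrix n n ℝ := L - a • vecMulVec u u
  have huM : u ᵥ* M = 0 := by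
    rw [vecMul_sub, huL, vecMul_smul, vecMul_vecMulVec, smul_smul, div_mul_cancel₀ _ huu.ne',
      sub_self]
  have hspec : ∀ μ ∈ spectrum ℂ (M.map Complex.ofReal), ‖μ‖ < ρ := by
    intro μ hμ
    obtain ⟨w, hw, hMw⟩ := mem_spectrum_iff_exists_mulVec.1 hμ
    by_cases hμ0 : μ = 0
    · simpa [hμ0] using hρ
    have huw : (fun i => (u i : ℂ)) ⬝ᵥ w = 0 := by
      have h1 := congrArg (fun z => (fun i => (u i : ℂ)) ⬝ᵥ z) hMw
      have h2 : (fun i => (u i : ℂ)) ᵥ* M.map Complex.ofReal = 0 := by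
        ext i
        have := Complex.ofRealHom.map_vecMul M u i
        rw [huM] at this
        exact this.symm.trans (by simp)
      simp only [dotProduct_mulVec, h2, zero_dotProduct, dotProduct_smul, smul_eq_mul] at h1
      exact (mul_eq_zero.1 h1.symm).resolve_left hμ0
    refine norm_lt_of_pos_left_eigenvector hL hpos hu huL hw ?_ huw
    rw [← hMw]
    ext i
    have h3 : ∀ j, (M.map Complex.ofReal) i j * w j
        = (L.map Complex.ofReal) i j * w j - a * u i * (u j * w j) := fun j => by
      simp only [M, map_apply, sub_apply, smul_apply, vecMulVec_apply, smul_eq_mul]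
      push_cast
      ring
    simp only [mulVec, dotProduct, h3, Finset.sum_sub_distrib, ← Finset.mul_sum]
    rw [show ∑ i, (u i : ℂ) * w i = 0 from huw, mul_zero, sub_zero]
  obtain ⟨μ₀, hμ₀, hmax⟩ := exists_mem_spectrum_forall_norm_le (M.map Complex.ofReal)
  have hlt := hspec μ₀ hμ₀
  have hq : 0 < (‖μ₀‖ + ρ) / 2 := by positivity
  obtain ⟨C, hC, hb⟩ := exists_abs_pow_apply_le M hq fun z hz => by
    have := hmax z hz
    linarith
  set D : Matrix n n ℝ := L - ρ • (1 : Matrix n n ℝ)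
  -- Since `u D = 0`, the correction term disappears and `D L ^ t = M ^ t D`.
  have hsemi : SemiconjBy D L M := by
    have h1 : vecMulVec u u * D = 0 := by
      rw [vecMulVec_mul, vecMul_sub, huL, vecMul_smul, vecMul_one, sub_self]
      ext; simp [vecMulVec_apply]
    change D * L = M * D
    simp only [M, sub_mul, smul_mul_assoc, h1, smul_zero, sub_zero]
    simp [D, mul_sub, sub_mul]
  refine ⟨(‖μ₀‖ + ρ) / 2, C * (1 + ∑ i, ∑ j, |D i j|), hq, by linarith, ?_, fun t i j => ?_⟩
  · have : 0 ≤ ∑ i, ∑ j, |D i j| := by positivity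
    positivity
  rw [(hsemi.pow_right t).eq, mul_apply]
  calc |∑ k, (M ^ t) i k * D k j| ≤ ∑ k, |(M ^ t) i k * D k j| := Finset.abs_sum_le_sum_abs _ _
    _ ≤ ∑ k, C * ((‖μ₀‖ + ρ) / 2) ^ t * ∑ j, |D k j| := by
      refine Finset.sum_le_sum fun k _ => ?_
      rw [abs_mul]
      exact mul_le_mul (hb t i k) (Finset.single_le_sum (f := fun j => |D k j|)
        (fun _ _ => abs_nonneg _) (Finset.mem_univ j)) (abs_nonneg _) (by positivity)
    _ = C * (∑ i, ∑ j, |D i j|) * ((‖μ₀‖ + ρ) / 2) ^ t := by rw [← Finset.mul_sum]; ring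
    _ ≤ _ := by gcongr; linarith

end Perron

end Matrix

/-! ### Exponential bounds without a prefactor -/

theorem exists_le_exp_of_lt_one {f : ℕ → ℝ} (h1 : ∀ t, f t < 1) (T : ℕ) :
    ∃ C : ℝ, 0 < C ∧ ∀ t : ℕ, 0 < t → t < T → f t ≤ Real.exp (-C * t) := by
  induction T with
  | zero => exact ⟨1, one_pos, fun t _ h => absurd h (Nat.not_lt_zero t)⟩
  | succ T ih =>
    obtain ⟨C, hC, h⟩ := ih
    have hlim : Tendsto (fun c : ℝ => Real.exp (-c * T)) (𝓝[>] 0) (𝓝 1) := by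
      have : Continuous fun c : ℝ => Real.exp (-c * T) := by fun_prop
      simpa using (this.tendsto 0).mono_left nhdsWithin_le_nhds
    obtain ⟨c, hc, hc0⟩ := ((hlim.eventually (lt_mem_nhds (h1 T))).and self_mem_nhdsWithin).exists
    refine ⟨min C c, lt_min hC hc0, fun t ht htT => ?_⟩
    rcases Nat.lt_succ_iff_lt_or_eq.1 htT with hlt | rfl
    · refine (h t ht hlt).trans (Real.exp_le_exp.2 ?_)
      gcongr
      exact min_le_left _ _
    · refine hc.le.trans (Real.exp_le_exp.2 ?_)
      gcongr
      exact min_le_right _ _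

/-- A sequence below `1` with geometric decay is dominated by a decaying exponential. -/
theorem exists_le_exp_of_le_geometric {f : ℕ → ℝ} {K p : ℝ} (hp : 0 < p) (hp1 : p < 1)
    (hf : ∀ t, f t ≤ K * p ^ t) (h1 : ∀ t, f t < 1) :
    ∃ C : ℝ, 0 < C ∧ ∀ t : ℕ, 0 < t → f t ≤ Real.exp (-C * t) := by
  have hs : 0 < √p := Real.sqrt_pos.2 hp
  have hs1 : √p < 1 := (Real.sqrt_lt' one_pos).2 (by simpa using hp1)
  -- Write `p ^ t = √p ^ t * √p ^ t`: one factor eventually absorbs `K`, the other gives the decay.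
  have hlim : Tendsto (fun t : ℕ => K * √p ^ t) atTop (𝓝 0) := by
    simpa using (tendsto_pow_atTop_nhds_zero_of_lt_one hs.le hs1).const_mul K
  obtain ⟨T, hT⟩ := eventually_atTop.1 (hlim.eventually (ge_mem_nhds one_pos))
  obtain ⟨C, hC, h⟩ := exists_le_exp_of_lt_one h1 T
  have hlog : 0 < -Real.log √p := neg_pos.2 (Real.log_neg hs hs1)
  refine ⟨min C (-Real.log √p), lt_min hC hlog, fun t ht => ?_⟩
  rcases lt_or_ge t T with hlt | hge
  · refine (h t ht hlt).trans (Real.exp_le_exp.2 ?_)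
    gcongr
    exact min_le_left _ _
  · have hle : f t ≤ √p ^ t := by
      refine (hf t).trans ?_
      conv_lhs => rw [← Real.mul_self_sqrt hp.le, mul_pow, ← mul_assoc]
      exact mul_le_of_le_one_left (by positivity) (hT t hge)
    refine hle.trans ?_
    rw [← Real.exp_log (pow_pos hs t), Real.log_pow, Real.exp_le_exp]
    have := mul_le_mul_of_nonneg_right (min_le_right C (-Real.log √p)) (Nat.cast_nonneg (α := ℝ) t)
    linarith

/-! ### The Dirichlet energy as a quadratic form -/

namespace Digraph

variable {V κ : Type*} {G : Digraph V} [Fintype V] [Fintype κ]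

theorem dirichletEnergy_smul (c : ℝ) (x : Matrix V κ ℝ) :
    G.dirichletEnergy (c • x) = c ^ 2 * G.dirichletEnergy x := by
  unfold dirichletEnergy
  simp only [Finset.mul_sum, Matrix.smul_apply, smul_eq_mul]
  refine Finset.sum_congr rfl fun i _ => Finset.sum_congr rfl fun j _ =>
    Finset.sum_congr rfl fun k _ => ?_
  ring

theorem dirichletEnergy_normalizeFeatures (x : Matrix V κ ℝ) :
    G.dirichletEnergy (normalizeFeatures x) =
      (∑ i, ∑ k, x i k ^ 2)⁻¹ * G.dirichletEnergy x := by
  have : 0 ≤ ∑ i, ∑ k, x i k ^ 2 := by positivity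
  rw [normalizeFeatures, dirichletEnergy_smul, inv_pow, Real.sq_sqrt this]

variable [DecidableEq V]

/-- In the expanded squares the row and column sums of the adjacency matrix cancel the degrees. The
sign `s = 1` gives the energy; `s = -1` gives the lower bound on `⟨x, L x⟩` and its equality case.
-/
theorem sum_adjacency_mul_sub_sq (hin : ∀ i, 0 < G.inDeg i) (hout : ∀ i, 0 < G.outDeg i)
    {s : ℝ} (hs : s ^ 2 = 1) (x : Matrix V κ ℝ) :
    ∑ i, ∑ j, G.adjacency i j *
        ∑ k, (x i k / √(G.inDeg i) - s * (x j k / √(G.outDeg j))) ^ 2 =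
      2 * (∑ i, ∑ k, x i k ^ 2 - s * ∑ i, ∑ k, x i k * (G.sna * x) i k) := by
  have hexp : ∀ i j k, G.adjacency i j *
      (x i k / √(G.inDeg i) - s * (x j k / √(G.outDeg j))) ^ 2 =
      G.adjacency i j * (x i k ^ 2 * (G.inDeg i)⁻¹)
        + G.adjacency i j * (x j k ^ 2 * (G.outDeg j)⁻¹)
        - 2 * s * (x i k * (G.sna i j * x j k)) := by
    intro i j k
    have h1 : (G.inDeg i)⁻¹ = (√(G.inDeg i))⁻¹ ^ 2 := by rw [inv_pow, Real.sq_sqrt (hin i).le]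
    have h2 : (G.outDeg j)⁻¹ = (√(G.outDeg j))⁻¹ ^ 2 := by rw [inv_pow, Real.sq_sqrt (hout j).le]
    rw [sna_apply]
    linear_combination G.adjacency i j * (x j k) ^ 2 * (√(G.outDeg j))⁻¹ ^ 2 * hs
      - G.adjacency i j * x i k ^ 2 * h1 - G.adjacency i j * x j k ^ 2 * h2
  have e1 : ∑ i, ∑ j, ∑ k, G.adjacency i j * (x i k ^ 2 * (G.inDeg i)⁻¹) =
      ∑ i, ∑ k, x i k ^ 2 := by
    refine Finset.sum_congr rfl fun i _ => ?_
    rw [Finset.sum_comm]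
    refine Finset.sum_congr rfl fun k _ => ?_
    rw [← Finset.sum_mul]
    change G.inDeg i * _ = _
    rw [mul_left_comm, mul_inv_cancel₀ (hin i).ne', mul_one]
  have e2 : ∑ i, ∑ j, ∑ k, G.adjacency i j * (x j k ^ 2 * (G.outDeg j)⁻¹) =
      ∑ i, ∑ k, x i k ^ 2 := by
    rw [Finset.sum_comm]
    refine Finset.sum_congr rfl fun j _ => ?_
    rw [Finset.sum_comm]
    refine Finset.sum_congr rfl fun k _ => ?_
    rw [← Finset.sum_mul]
    change G.outDeg j * _ = _
    rw [mul_left_comm, mul_inv_cancel₀ (hout j).ne', mul_one]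
  have e3 : ∑ i, ∑ j, ∑ k, 2 * s * (x i k * (G.sna i j * x j k)) =
      2 * s * ∑ i, ∑ k, x i k * (G.sna * x) i k := by
    rw [Finset.mul_sum]
    refine Finset.sum_congr rfl fun i _ => ?_
    rw [Finset.sum_comm, Finset.mul_sum]
    refine Finset.sum_congr rfl fun k _ => ?_
    rw [Matrix.mul_apply, Finset.mul_sum, Finset.mul_sum]
  have hl : ∑ i, ∑ j, G.adjacency i j *
        ∑ k, (x i k / √(G.inDeg i) - s * (x j k / √(G.outDeg j))) ^ 2 =
      ∑ i, ∑ j, ∑ k, G.adjacency i j *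
        (x i k / √(G.inDeg i) - s * (x j k / √(G.outDeg j))) ^ 2 :=
    Finset.sum_congr rfl fun i _ => Finset.sum_congr rfl fun j _ => Finset.mul_sum _ _ _
  rw [hl]
  simp only [hexp, Finset.sum_sub_distrib, Finset.sum_add_distrib, e1, e2, e3]
  ring

theorem dirichletEnergy_eq (hin : ∀ i, 0 < G.inDeg i) (hout : ∀ i, 0 < G.outDeg i)
    (x : Matrix V κ ℝ) :
    G.dirichletEnergy x =
      (∑ i, ∑ k, x i k ^ 2 - ∑ i, ∑ k, x i k * (G.sna * x) i k) / 2 := by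
  have := sum_adjacency_mul_sub_sq hin hout (s := 1) (by norm_num) x
  simp only [one_mul] at this
  rw [dirichletEnergy, this]
  ring

theorem sum_mul_sna_mul_le (hin : ∀ i, 0 < G.inDeg i) (hout : ∀ i, 0 < G.outDeg i)
    (x : Matrix V κ ℝ) : ∑ i, ∑ k, x i k * (G.sna * x) i k ≤ ∑ i, ∑ k, x i k ^ 2 := by
  have h := sum_adjacency_mul_sub_sq hin hout (s := 1) (by norm_num) x
  have : 0 ≤ ∑ i, ∑ j, G.adjacency i j *
      ∑ k, (x i k / √(G.inDeg i) - 1 * (x j k / √(G.outDeg j))) ^ 2 :=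
    Finset.sum_nonneg fun i _ => Finset.sum_nonneg fun j _ =>
      mul_nonneg (adjacency_nonneg i j) (Finset.sum_nonneg fun k _ => sq_nonneg _)
  linarith

theorem neg_sum_sq_le (hin : ∀ i, 0 < G.inDeg i) (hout : ∀ i, 0 < G.outDeg i)
    (x : Matrix V κ ℝ) : -∑ i, ∑ k, x i k ^ 2 ≤ ∑ i, ∑ k, x i k * (G.sna * x) i k := by
  have h := sum_adjacency_mul_sub_sq hin hout (s := -1) (by norm_num) x
  have : 0 ≤ ∑ i, ∑ j, G.adjacency i j *
      ∑ k, (x i k / √(G.inDeg i) - -1 * (x j k / √(G.outDeg j))) ^ 2 :=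
    Finset.sum_nonneg fun i _ => Finset.sum_nonneg fun j _ =>
      mul_nonneg (adjacency_nonneg i j) (Finset.sum_nonneg fun k _ => sq_nonneg _)
  linarith

theorem sna_mul_eq_neg (hin : ∀ i, 0 < G.inDeg i) (hout : ∀ i, 0 < G.outDeg i)
    {x : Matrix V κ ℝ} (h : ∑ i, ∑ k, x i k * (G.sna * x) i k = -∑ i, ∑ k, x i k ^ 2) :
    G.sna * x = -x := by
  have h0 := sum_adjacency_mul_sub_sq hin hout (s := -1) (by norm_num) x
  rw [h, neg_one_mul, neg_neg, sub_self, mul_zero] at h0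
  have hk : ∀ i j, 0 ≤ ∑ k, (x i k / √(G.inDeg i) - -1 * (x j k / √(G.outDeg j))) ^ 2 :=
    fun i j => Finset.sum_nonneg fun k _ => sq_nonneg _
  have hj : ∀ i j, 0 ≤ G.adjacency i j *
      ∑ k, (x i k / √(G.inDeg i) - -1 * (x j k / √(G.outDeg j))) ^ 2 :=
    fun i j => mul_nonneg (adjacency_nonneg i j) (hk i j)
  have h1 : ∀ i j, G.adjacency i j *
      ∑ k, (x i k / √(G.inDeg i) - -1 * (x j k / √(G.outDeg j))) ^ 2 = 0 := fun i j =>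
    (Finset.sum_eq_zero_iff_of_nonneg fun j _ => hj i j).1
      ((Finset.sum_eq_zero_iff_of_nonneg fun i _ => Finset.sum_nonneg fun j _ => hj i j).1 h0 i
        (Finset.mem_univ i)) j (Finset.mem_univ j)
  have h2 : ∀ i j k, G.adjacency i j * (x j k / √(G.outDeg j)) =
      -(G.adjacency i j * (x i k / √(G.inDeg i))) := by
    intro i j k
    rcases mul_eq_zero.1 (h1 i j) with ha | hs
    · simp [ha]
    · have := (Finset.sum_eq_zero_iff_of_nonneg fun k _ => sq_nonneg _).1 hs k (Finset.mem_univ k)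
      linear_combination G.adjacency i j * (pow_eq_zero_iff two_ne_zero).1 this
  ext i k
  have h3 : ∀ j, G.sna i j * x j k =
      -((√(G.inDeg i))⁻¹ * (x i k / √(G.inDeg i)) * G.adjacency i j) := fun j => by
    rw [sna_apply]
    linear_combination (√(G.inDeg i))⁻¹ * h2 i j k
  rw [Matrix.mul_apply, Finset.sum_congr rfl fun j _ => h3 j, Finset.sum_neg_distrib,
    ← Finset.mul_sum, Matrix.neg_apply]
  change -(_ * G.inDeg i) = _
  have hsq := Real.mul_self_sqrt (hin i).le
  have hne := (Real.sqrt_pos.2 (hin i)).ne'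
  rw [← hsq]
  rw [Real.sqrt_mul_self (Real.sqrt_nonneg _)]
  field_simp

theorem gcn_eq [DecidableEq κ] (W : Matrix κ κ ℝ) (x₀ : Matrix V κ ℝ) (t : ℕ) :
    G.gcn W x₀ t = G.sna ^ t * x₀ * W ^ t := by
  induction t with
  | zero => simp [gcn]
  | succ t ih => rw [gcn, ih, pow_succ', pow_succ]; simp only [Matrix.mul_assoc]

end Digraph

theorem abs_apply_le_sqrt_sum_sq {V κ : Type*} [Fintype V] [Fintype κ] (x : Matrix V κ ℝ)
    (i : V) (k : κ) : |x i k| ≤ √(∑ i, ∑ k, x i k ^ 2) := by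
  refine Real.abs_le_sqrt ?_
  refine (Finset.single_le_sum (f := fun k => x i k ^ 2) (fun _ _ => sq_nonneg _)
    (Finset.mem_univ k)).trans ?_
  exact Finset.single_le_sum (f := fun i => ∑ k, x i k ^ 2)
    (fun _ _ => Finset.sum_nonneg fun _ _ => sq_nonneg _) (Finset.mem_univ i)

theorem sum_sq_pos_of_ne_zero {V κ : Type*} [Fintype V] [Fintype κ] {x : Matrix V κ ℝ}
    (hx : x ≠ 0) : 0 < ∑ i, ∑ k, x i k ^ 2 := by
  obtain ⟨i, hi⟩ := Function.ne_iff.1 hx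
  obtain ⟨k, hk⟩ := Function.ne_iff.1 hi
  exact Real.sqrt_pos.1 ((abs_pos.2 hk).trans_le (abs_apply_le_sqrt_sum_sq x i k))

/-! ### Lowest frequency and deviation of the energy -/

namespace Digraph

variable {V κ : Type*} {G : Digraph V} [Fintype V] [Fintype κ] [DecidableEq V]

theorem isLowestFrequency_one_sub {ρ : ℝ} {u : V → ℝ} [Nonempty V] (hu : ∀ i, 0 < u i)
    (huL : Matrix.vecMul u G.sna = ρ • u) : G.IsLowestFrequency (1 - ρ) := by
  have hmap : (1 - G.sna).map (fun r : ℝ => (r : ℂ)) = 1 - G.sna.map Complex.ofReal :=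
    (map_sub Complex.ofRealHom.mapMatrix 1 G.sna).trans (by rw [map_one]; rfl)
  have hmem : ∀ z : ℂ, z ∈ G.frequencies ↔ 1 - z ∈ spectrum ℂ (G.sna.map Complex.ofReal) := by
    intro z
    rw [frequencies, hmap]
    simp only [Matrix.mem_spectrum_iff_exists_mulVec, Matrix.sub_mulVec, Matrix.one_mulVec]
    refine exists_congr fun w => and_congr_right fun _ => ?_
    rw [sub_smul, one_smul]
    constructor <;> intro h
    · rw [← h]; abel
    · rw [h]; abel
  refine ⟨?_, fun z hz => ?_⟩
  -- Transposition preserves the characteristic polynomial, so the left eigenvector suffices.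
  · rw [hmem, Matrix.mem_spectrum_iff_isRoot_charpoly, ← Matrix.charpoly_transpose,
      ← Matrix.mem_spectrum_iff_isRoot_charpoly, Matrix.mem_spectrum_iff_exists_mulVec]
    refine ⟨fun i => (u i : ℂ), ?_, ?_⟩
    · obtain ⟨i⟩ := ‹Nonempty V›
      exact Function.ne_iff.2 ⟨i, by simpa using (hu i).ne'⟩
    · ext i
      have h := Complex.ofRealHom.map_vecMul G.sna u i
      rw [huL] at h
      rw [Matrix.mulVec_transpose]
      exact h.symm.trans (by simp)
  · obtain ⟨w, hw, h⟩ := Matrix.mem_spectrum_iff_exists_mulVec.1 ((hmem z).1 hz)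
    have h1 := Matrix.norm_le_of_pos_left_eigenvector sna_nonneg hu huL hw h
    have h2 := (Complex.re_le_norm (1 - z)).trans h1
    rw [Complex.sub_re, Complex.one_re] at h2
    linarith

theorem le_one_of_pos_left_eigenvector [Nonempty V] (hin : ∀ i, 0 < G.inDeg i)
    (hout : ∀ i, 0 < G.outDeg i) {ρ : ℝ} {u : V → ℝ} (hu : ∀ i, 0 < u i)
    (huL : Matrix.vecMul u G.sna = ρ • u) : ρ ≤ 1 := by
  have h := sum_mul_sna_mul_le hin hout (Matrix.of fun (i : V) (_ : Unit) => u i)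
  have hpos : 0 < ∑ i, u i ^ 2 :=
    Finset.sum_pos (fun i _ => pow_pos (hu i) 2) Finset.univ_nonempty
  have h2 : ∑ i, u i * ∑ j, G.sna i j * u j = ρ * ∑ i, u i ^ 2 := by
    change u ⬝ᵥ (G.sna.mulVec u) = _
    rw [Matrix.dotProduct_mulVec, huL, smul_dotProduct, dotProduct, smul_eq_mul]
    simp only [sq]
  simp only [Finset.univ_unique, Finset.sum_singleton, Matrix.of_apply, Matrix.mul_apply, h2] at h
  exact le_of_mul_le_mul_right (by linarith) hpos

theorem dirichletEnergy_normalizeFeatures_sub (hin : ∀ i, 0 < G.inDeg i)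
    (hout : ∀ i, 0 < G.outDeg i) (ρ : ℝ) {x : Matrix V κ ℝ} (hx : x ≠ 0) :
    G.dirichletEnergy (normalizeFeatures x) - (1 - ρ) / 2 =
      -(∑ i, ∑ k, x i k * ((G.sna - ρ • (1 : Matrix V V ℝ)) * x) i k) /
        (2 * ∑ i, ∑ k, x i k ^ 2) := by
  have hS := (sum_sq_pos_of_ne_zero hx).ne'
  have h : ∑ i, ∑ k, x i k * ((G.sna - ρ • (1 : Matrix V V ℝ)) * x) i k =
      ∑ i, ∑ k, x i k * (G.sna * x) i k - ρ * ∑ i, ∑ k, x i k ^ 2 := by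
    simp only [Finset.mul_sum, ← Finset.sum_sub_distrib]
    refine Finset.sum_congr rfl fun i _ => Finset.sum_congr rfl fun k _ => ?_
    simp only [Matrix.sub_mul, Matrix.smul_mul, Matrix.one_mul, Matrix.sub_apply,
      Matrix.smul_apply, smul_eq_mul]
    ring
  rw [dirichletEnergy_normalizeFeatures, dirichletEnergy_eq hin hout, h]
  field_simp
  ring

theorem abs_dirichletEnergy_normalizeFeatures_sub_le (hin : ∀ i, 0 < G.inDeg i)
    (hout : ∀ i, 0 < G.outDeg i) (ρ : ℝ) {x : Matrix V κ ℝ} (hx : x ≠ 0) :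
    |G.dirichletEnergy (normalizeFeatures x) - (1 - ρ) / 2| ≤
      (∑ i, ∑ k, |((G.sna - ρ • (1 : Matrix V V ℝ)) * x) i k|) /
        √(∑ i, ∑ k, x i k ^ 2) := by
  rw [dirichletEnergy_normalizeFeatures_sub hin hout ρ hx]
  have hS := sum_sq_pos_of_ne_zero hx
  set f := (G.sna - ρ • (1 : Matrix V V ℝ)) * x
  have hle : |∑ i, ∑ k, x i k * f i k| ≤
      √(∑ i, ∑ k, x i k ^ 2) * ∑ i, ∑ k, |f i k| := by
    simp only [Finset.mul_sum]
    refine (Finset.abs_sum_le_sum_abs _ _).trans (Finset.sum_le_sum fun i _ => ?_)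
    refine (Finset.abs_sum_le_sum_abs _ _).trans (Finset.sum_le_sum fun k _ => ?_)
    rw [abs_mul]
    exact mul_le_mul_of_nonneg_right (abs_apply_le_sqrt_sum_sq x i k) (abs_nonneg _)
  have hpos := Real.sqrt_pos.2 hS
  rw [abs_div, abs_neg, abs_of_pos (show 0 < 2 * ∑ i, ∑ k, x i k ^ 2 by positivity),
    div_le_div_iff₀ (by positivity) hpos]
  have hsq := Real.mul_self_sqrt hS.le
  have h0 : 0 ≤ ∑ i, ∑ k, |f i k| := by positivity
  set r := √(∑ i, ∑ k, x i k ^ 2)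
  rw [← hsq]
  have := mul_le_mul_of_nonneg_right hle hpos.le
  nlinarith [mul_nonneg h0 (mul_self_nonneg r)]

/-- From `|⟨x, L x⟩| ≤ ‖x‖²` and `0 < ρ ≤ 1`, a deviation of `1` forces `ρ = 1` and `L x = -x`. Then
`(L - ρ) L ^ t x` has constant size, against its decay. -/
theorem abs_dirichletEnergy_normalizeFeatures_sub_lt_one (hin : ∀ i, 0 < G.inDeg i)
    (hout : ∀ i, 0 < G.outDeg i) {ρ q C : ℝ} (hρ : 0 < ρ) (hρ1 : ρ ≤ 1) (hq : 0 < q) (hqρ : q < ρ)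
    (hdec : ∀ t i j, |((G.sna - ρ • (1 : Matrix V V ℝ)) * G.sna ^ t) i j| ≤ C * q ^ t)
    {x : Matrix V κ ℝ} (hx : x ≠ 0) :
    |G.dirichletEnergy (normalizeFeatures x) - (1 - ρ) / 2| < 1 := by
  have hS := sum_sq_pos_of_ne_zero hx
  have h1 := sum_mul_sna_mul_le hin hout x
  have h2 := neg_sum_sq_le hin hout x
  rw [dirichletEnergy_normalizeFeatures, dirichletEnergy_eq hin hout]
  set S := ∑ i, ∑ k, x i k ^ 2 with hSdef
  set P := ∑ i, ∑ k, x i k * (G.sna * x) i k with hP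
  have hval : S⁻¹ * ((S - P) / 2) - (1 - ρ) / 2 = (ρ * S - P) / (2 * S) := by
    field_simp
    ring
  rw [hval, abs_lt, lt_div_iff₀ (by positivity), div_lt_iff₀ (by positivity)]
  refine ⟨by nlinarith, ?_⟩
  by_contra! hge
  have hρS : ρ * S ≤ 1 * S := mul_le_mul_of_nonneg_right hρ1 hS.le
  have hPS : P = -S := by linarith
  have hρ_eq : ρ = 1 := le_antisymm hρ1 (le_of_mul_le_mul_right (by linarith) hS)
  have hneg := sna_mul_eq_neg hin hout hPS
  have hpow : ∀ t : ℕ, G.sna ^ t * x = (-1 : ℝ) ^ t • x := by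
    intro t
    induction t with
    | zero => simp
    | succ t ih => rw [pow_succ, Matrix.mul_assoc, hneg, Matrix.mul_neg, ih, pow_succ]; simp
  apply hx
  ext i k
  have hb : ∀ t : ℕ, 2 * |x i k| ≤ (C * ∑ j, |x j k|) * q ^ t := by
    intro t
    have hDx : ((G.sna - ρ • (1 : Matrix V V ℝ)) * G.sna ^ t * x) i k =
        (-1) ^ t * (-2 * x i k) := by
      rw [Matrix.mul_assoc, hpow, Matrix.mul_smul, Matrix.sub_mul, hneg, hρ_eq, one_smul,
        Matrix.one_mul]
      simp only [Matrix.smul_apply, Matrix.sub_apply, Matrix.neg_apply, smul_eq_mul]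
      ring
    calc 2 * |x i k| = |((G.sna - ρ • (1 : Matrix V V ℝ)) * G.sna ^ t * x) i k| := by
          rw [hDx]; simp [abs_mul]
      _ ≤ ∑ j, |((G.sna - ρ • (1 : Matrix V V ℝ)) * G.sna ^ t) i j * x j k| :=
          Finset.abs_sum_le_sum_abs _ _
      _ ≤ ∑ j, C * q ^ t * |x j k| := by
          refine Finset.sum_le_sum fun j _ => ?_
          rw [abs_mul]
          exact mul_le_mul_of_nonneg_right (hdec t i j) (abs_nonneg _)
      _ = (C * ∑ j, |x j k|) * q ^ t := by rw [← Finset.mul_sum]; ring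
  have hlim : Tendsto (fun t : ℕ => (C * ∑ j, |x j k|) * q ^ t) atTop (𝓝 0) := by
    simpa using (tendsto_pow_atTop_nhds_zero_of_lt_one hq.le (by linarith)).const_mul _
  have h0 := ge_of_tendsto' hlim hb
  have := abs_nonneg (x i k)
  exact abs_eq_zero.1 (by linarith)

/-- The pairing of real features with a node vector `u` and a complex channel vector `w`. -/
noncomputable def featurePairing (u : V → ℝ) (w : κ → ℂ) : Matrix V κ ℝ →ₗ[ℝ] ℂ where
  toFun x := ∑ i, ∑ k, (u i : ℂ) * ((x i k : ℂ) * w k)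
  map_add' x y := by
    simp only [Matrix.add_apply, Complex.ofReal_add, add_mul, mul_add, Finset.sum_add_distrib]
  map_smul' c x := by
    simp only [Matrix.smul_apply, smul_eq_mul, Complex.ofReal_mul, RingHom.id_apply,
      Complex.real_smul, Finset.mul_sum]
    refine Finset.sum_congr rfl fun i _ => Finset.sum_congr rfl fun k _ => ?_
    ring

omit [DecidableEq V] in
theorem featurePairing_eq (u : V → ℝ) (w : κ → ℂ) (x : Matrix V κ ℝ) :
    featurePairing u w x = (fun i => (u i : ℂ)) ⬝ᵥ (x.map Complex.ofReal).mulVec w := by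
  simp only [featurePairing, LinearMap.coe_mk, AddHom.coe_mk, dotProduct, Matrix.mulVec,
    Matrix.map_apply, Finset.mul_sum]

omit [DecidableEq V] in
theorem norm_featurePairing_le (u : V → ℝ) (w : κ → ℂ) (x : Matrix V κ ℝ) :
    ‖featurePairing u w x‖ ≤ (∑ i, ∑ k, |u i| * ‖w k‖) * √(∑ i, ∑ k, x i k ^ 2) := by
  simp only [featurePairing, LinearMap.coe_mk, AddHom.coe_mk, Finset.sum_mul]
  refine (norm_sum_le _ _).trans (Finset.sum_le_sum fun i _ => ?_)
  refine (norm_sum_le _ _).trans (Finset.sum_le_sum fun k _ => ?_)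
  rw [norm_mul, norm_mul, Complex.norm_real, Complex.norm_real, Real.norm_eq_abs, Real.norm_eq_abs,
    mul_assoc, mul_comm (‖w k‖)]
  exact mul_le_mul_of_nonneg_left
    (mul_le_mul_of_nonneg_right (abs_apply_le_sqrt_sum_sq x i k) (norm_nonneg _)) (abs_nonneg _)

-- This eigenvalue relation provides the lower bound on the features. The vector `w` is complex
-- because a dominant eigenvalue of `W` need not be real.
omit [DecidableEq V] in
theorem featurePairing_mul_mul {L : Matrix V V ℝ} {W : Matrix κ κ ℝ} {ρ : ℝ} {μ : ℂ} {u : V → ℝ}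
    {w : κ → ℂ} (hu : Matrix.vecMul u L = ρ • u)
    (hw : (W.map Complex.ofReal).mulVec w = μ • w) (x : Matrix V κ ℝ) :
    featurePairing u w (L * x * W) = ρ * μ * featurePairing u w x := by
  have hu' : Matrix.vecMul (fun i => (u i : ℂ)) (L.map Complex.ofReal) =
      (ρ : ℂ) • fun i => (u i : ℂ) := by
    ext i
    have h := Complex.ofRealHom.map_vecMul L u i
    rw [hu] at h
    exact h.symm.trans (by simp)
  have hmul : (L * x * W).map Complex.ofReal =
      L.map Complex.ofReal * x.map Complex.ofReal * W.map Complex.ofReal := by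
    exact (Matrix.map_mul (f := Complex.ofRealHom)).trans
      (congrArg (· * W.map Complex.ofReal) (Matrix.map_mul (f := Complex.ofRealHom)))
  rw [featurePairing_eq, featurePairing_eq, hmul, ← Matrix.mulVec_mulVec, hw, Matrix.mulVec_smul,
    ← Matrix.mulVec_mulVec, dotProduct_smul, Matrix.dotProduct_mulVec, hu', smul_dotProduct]
  simp only [smul_eq_mul]
  ring

theorem featurePairing_gcn {W : Matrix κ κ ℝ} {ρ : ℝ} {μ : ℂ} {u : V → ℝ}
    {w : κ → ℂ} (hu : Matrix.vecMul u G.sna = ρ • u)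
    (hw : (W.map Complex.ofReal).mulVec w = μ • w) (x₀ : Matrix V κ ℝ) (t : ℕ) :
    featurePairing u w (G.gcn W x₀ t) = (ρ * μ) ^ t * featurePairing u w x₀ := by
  induction t with
  | zero => simp [gcn]
  | succ t ih => rw [gcn, featurePairing_mul_mul hu hw, ih, pow_succ']; ring

omit [DecidableEq V] in
/-- Almost all features have a nonzero pairing with given nonzero vectors. -/
theorem ae_featurePairing_ne_zero [Nonempty V] {u : V → ℝ} (hu : ∀ i, 0 < u i) {w : κ → ℂ}
    (hw : w ≠ 0) : ∀ᵐ x : V → κ → ℝ, featurePairing u w (Matrix.of x) ≠ 0 := by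
  let φ : (V → κ → ℝ) →ₗ[ℝ] ℂ := featurePairing u w
  have hker : LinearMap.ker φ ≠ ⊤ := by
    classical
    intro htop
    obtain ⟨i⟩ := ‹Nonempty V›
    obtain ⟨k, hk⟩ := Function.ne_iff.1 hw
    have h : featurePairing u w (Matrix.single i k 1) = 0 :=
      LinearMap.congr_fun (LinearMap.ker_eq_top.1 htop) _
    have h2 : featurePairing u w (Matrix.single i k 1) = u i * w k := by
      simp only [featurePairing, LinearMap.coe_mk, AddHom.coe_mk]
      rw [Finset.sum_eq_single i, Finset.sum_eq_single k]
      all_goals simp +contextual [Matrix.single_apply, eq_comm]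
    rw [h2] at h
    rcases mul_eq_zero.1 h with h | h
    · exact (hu i).ne' (by exact_mod_cast h)
    · exact hk h
  -- The exceptional features form a proper subspace, which is Lebesgue-null.
  have h0 := Measure.addHaar_submodule (volume : Measure (V → κ → ℝ)) _ hker
  rw [ae_iff]
  convert! h0 using 2
  ext x
  simp [φ]
  rfl

end Digraph

/-- The spectral radius of a non-nilpotent real matrix is positive and is attained by an
eigenvector. -/
theorem Matrix.exists_dominant_eigenvector {κ : Type*} [Fintype κ] [DecidableEq κ]
    {W : Matrix κ κ ℝ} (hW : ¬ IsNilpotent W) :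
    ∃ (μ : ℂ) (w : κ → ℂ), w ≠ 0 ∧ (W.map Complex.ofReal).mulVec w = μ • w ∧ 0 < ‖μ‖ ∧
      ∀ z ∈ spectrum ℂ (W.map Complex.ofReal), ‖z‖ ≤ ‖μ‖ := by
  have : Nonempty κ := by
    by_contra h
    rw [not_nonempty_iff] at h
    exact hW ⟨0, Subsingleton.elim _ _⟩
  obtain ⟨μ, hμ, hmax⟩ := exists_mem_spectrum_forall_norm_le (W.map Complex.ofReal)
  obtain ⟨w, hw, hWw⟩ := mem_spectrum_iff_exists_mulVec.1 hμ
  refine ⟨μ, w, hw, hWw, (norm_nonneg μ).lt_of_ne fun h0 => hW ?_, hmax⟩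
  obtain ⟨t, ht⟩ := isNilpotent_of_spectrum_eq_zero (W.map Complex.ofReal) fun z hz =>
    norm_le_zero_iff.1 ((hmax z hz).trans h0.ge)
  rw [map_ofReal_pow] at ht
  refine ⟨t, ?_⟩
  ext i j
  simpa using congrFun (congrFun ht i) j

/-! ### Upper bound for the features and conclusion -/

namespace Digraph

variable {V κ : Type*} {G : Digraph V} [Fintype V] [Fintype κ] [DecidableEq V] [DecidableEq κ]

theorem sum_abs_sub_smul_mul_gcn_le {W : Matrix κ κ ℝ} {ρ q c C₁ C₂ : ℝ}
    (hq : 0 < q) (hC₁ : 0 < C₁)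
    (hdec : ∀ t i j, |((G.sna - ρ • (1 : Matrix V V ℝ)) * G.sna ^ t) i j| ≤ C₁ * q ^ t)
    (hW : ∀ t k l, |(W ^ t) k l| ≤ C₂ * c ^ t) (x₀ : Matrix V κ ℝ) (t : ℕ) :
    ∑ i, ∑ k, |((G.sna - ρ • (1 : Matrix V V ℝ)) * G.gcn W x₀ t) i k| ≤
      (∑ _i : V, ∑ _k : κ, C₁ * C₂ * ∑ l, ∑ j, |x₀ j l|) * (q * c) ^ t := by
  simp only [Finset.sum_mul]
  refine Finset.sum_le_sum fun i _ => Finset.sum_le_sum fun k _ => ?_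
  rw [gcn_eq, ← Matrix.mul_assoc, ← Matrix.mul_assoc, Matrix.mul_apply]
  refine (Finset.abs_sum_le_sum_abs _ _).trans ?_
  rw [Finset.mul_sum, Finset.sum_mul]
  refine Finset.sum_le_sum fun l _ => ?_
  rw [abs_mul, Matrix.mul_apply]
  have h : |∑ j, ((G.sna - ρ • (1 : Matrix V V ℝ)) * G.sna ^ t) i j * x₀ j l| ≤
      C₁ * q ^ t * ∑ j, |x₀ j l| := by
    rw [Finset.mul_sum]
    refine (Finset.abs_sum_le_sum_abs _ _).trans (Finset.sum_le_sum fun j _ => ?_)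
    rw [abs_mul]
    exact mul_le_mul_of_nonneg_right (hdec t i j) (abs_nonneg _)
  refine (mul_le_mul h (hW t l k) (abs_nonneg _) ?_).trans_eq ?_
  · have : 0 ≤ ∑ j, |x₀ j l| := by positivity
    positivity
  · rw [mul_pow]; ring

end Digraph

theorem mainTheorem11 {V κ : Type*} [Fintype V] [DecidableEq V] [Fintype κ] [DecidableEq κ]
    (G : Digraph V) (hconn : G.IsStronglyConnected) (haper : G.IsAperiodic)
    (W : Matrix κ κ ℝ) (hW : ¬ IsNilpotent W) :
    ∃ l : ℝ, 0 ≤ l ∧ G.IsLowestFrequency l ∧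
      ∀ᵐ x₀ : V → κ → ℝ,
        (∀ t : ℕ, G.gcn W (Matrix.of x₀) t ≠ 0) ∧
        G.IsFrequencyDominant (G.gcn W (Matrix.of x₀)) l ∧
        G.DecaysExponentially (G.gcn W (Matrix.of x₀)) l := by
  have : Nonempty V := haper.nonempty
  obtain ⟨hin, hout, m, hm, hpos⟩ := Digraph.exists_sna_pow_pos hconn haper
  obtain ⟨ρ, u, hρ, hu, huL⟩ := Matrix.exists_pos_eigenvector (L := G.sna.transpose)
    (fun i j => Digraph.sna_nonneg j i) hm (fun i j => by
      rw [← Matrix.transpose_pow]; exact hpos j i)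
  rw [Matrix.mulVec_transpose] at huL
  have hρ1 := Digraph.le_one_of_pos_left_eigenvector hin hout hu huL
  obtain ⟨q, C₁, hq, hqρ, hC₁, hdec⟩ :=
    Matrix.exists_abs_sub_smul_mul_pow_le Digraph.sna_nonneg hpos hρ hu huL
  obtain ⟨μ, w, hw, hWw, hμ, hmax⟩ := Matrix.exists_dominant_eigenvector hW
  -- Jordan blocks can prevent `W ^ t = O(‖μ‖ ^ t)`; the gap `q < ρ` leaves room for a larger rate
  -- `c` with `q c < ρ ‖μ‖`.
  obtain ⟨c, hμc, hc⟩ : ∃ c, ‖μ‖ < c ∧ c < ρ * ‖μ‖ / q :=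
    exists_between ((lt_div_iff₀ hq).2 (by nlinarith))
  have hc0 : 0 < c := hμ.trans hμc
  obtain ⟨C₂, -, hWc⟩ := Matrix.exists_abs_pow_apply_le W hc0 fun z hz => (hmax z hz).trans_lt hμc
  refine ⟨1 - ρ, sub_nonneg.2 hρ1, Digraph.isLowestFrequency_one_sub hu huL, ?_⟩
  filter_upwards [Digraph.ae_featurePairing_ne_zero hu hw] with x₀ hx₀
  set x := G.gcn W (Matrix.of x₀) with hx
  set φ := Digraph.featurePairing u w with hφ
  have hρμ : 0 < ρ * ‖μ‖ := mul_pos hρ hμ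
  have hφx : ∀ t, ‖φ (x t)‖ = (ρ * ‖μ‖) ^ t * ‖φ (Matrix.of x₀)‖ := fun t => by
    rw [hx, hφ, Digraph.featurePairing_gcn huL hWw, norm_mul, norm_pow, norm_mul,
      Complex.norm_real, Real.norm_of_nonneg hρ.le]
  have hφ0 : 0 < ‖φ (Matrix.of x₀)‖ := norm_pos_iff.2 hx₀
  have hne : ∀ t, x t ≠ 0 := fun t h => by
    have := hφx t
    rw [h, map_zero, norm_zero] at this
    exact (mul_pos (pow_pos hρμ t) hφ0).ne this
  set p := q * c / (ρ * ‖μ‖)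
  have hp : 0 < p := by positivity
  have hp1 : p < 1 := (div_lt_one hρμ).2 (by rw [lt_div_iff₀ hq] at hc; linarith)
  set A := ∑ i, ∑ k, |u i| * ‖w k‖
  set B := ∑ _i : V, ∑ _k : κ, C₁ * C₂ * ∑ l, ∑ j, |Matrix.of x₀ j l|
  have hbound : ∀ t, |G.dirichletEnergy (normalizeFeatures (x t)) - (1 - ρ) / 2| ≤
      B * A / ‖φ (Matrix.of x₀)‖ * p ^ t := by
    intro t
    refine (Digraph.abs_dirichletEnergy_normalizeFeatures_sub_le hin hout ρ (hne t)).trans ?_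
    have h1 := Digraph.sum_abs_sub_smul_mul_gcn_le hq hC₁ hdec hWc (Matrix.of x₀) t
    have h2 := Digraph.norm_featurePairing_le u w (x t)
    have hS := Real.sqrt_pos.2 (sum_sq_pos_of_ne_zero (hne t))
    have hB : 0 ≤ B * (q * c) ^ t := le_trans (by positivity) h1
    rw [← hφ, hφx] at h2
    rw [div_le_iff₀ hS]
    refine h1.trans ?_
    have hr := pow_pos hρμ t
    have e : B * A / ‖φ (Matrix.of x₀)‖ * p ^ t * √(∑ i, ∑ k, x t i k ^ 2) =
        B * (q * c) ^ t * (A * √(∑ i, ∑ k, x t i k ^ 2)) /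
          ((ρ * ‖μ‖) ^ t * ‖φ (Matrix.of x₀)‖) := by
      rw [div_pow]
      field_simp
    rw [e, le_div_iff₀ (mul_pos hr hφ0)]
    exact mul_le_mul_of_nonneg_left h2 hB
  refine ⟨hne, ?_, ?_⟩
  · refine tendsto_iff_norm_sub_tendsto_zero.2 (squeeze_zero (fun _ => norm_nonneg _) hbound ?_)
    simpa using (tendsto_pow_atTop_nhds_zero_of_lt_one hp.le hp1).const_mul _
  · exact exists_le_exp_of_le_geometric hp hp1 hbound fun t =>
      Digraph.abs_dirichletEnergy_normalizeFeatures_sub_lt_one hin hout hρ hρ1 hq hqρ hdec (hne t)
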